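/- Let $H$ be an infinite-dimensional separable real Hilbert space and let $C, C_{\mu_0}: H\to H$ be trace class, positive-definite, symmetric operators with a common orthonormal basis of eigenvectors $(e_j)$, $C e_j=\lambda_j e_j$ and $C_{\mu_0}e_j=\mu_{0j}e_j$. Put $p_0^{(j)}:=\lambda_j/\mu_{0j}\in(0,\infty)$ and $x^{(j)}:=\langle x,e_j\rangle$. Let $\mu_0=\mathcal N(0,C_{\mu_0})$, let $X_0\sim\mu_0$ be independent of a cylindrical Wiener process $W$ on $H$, and let $$X_\tau=e^{-\tau/2}X_0+\int_0^\tau e^{-(\tau-s)/2}\sqrt C\,dW_s ,\qquad \tau\ge 0 .$$ For $\tau>0$ and $x\in H$ let $$S(\tau,x;\mu_0)=-(1-e^{-\tau})^{-1}\bigl(x-e^{-\tau/2}\,\mathbb E[X_0\mid X_\tau=x]\bigr),$$ where $x\mapsto\mathbb E[X_0\mid X_\tau=x]$ denotes the continuous version of the regression function. Let $C C_{\mu_0}^{-1}$ denote the closure of the operator $C_{\mu_0}z\mapsto Cz$ defined on the range of $C_{\mu_0}$. Then the following hold. 1. For every $\tau>0$ the regression function has exactly one continuous version $H \to H$, so that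 $S(\tau,x;\mu_0)$ is well defined for every $x\in H$. 2. If $\sup_j p_0^{(j)}<\infty$, then the domain of $C C_{\mu_0}^{-1}$ is all of $H$. 3. For every $x$ in the domain of $C C_{\mu_0}^{-1}$ and every $\tau>0$, $$C C_{\mu_0}^{-1}x+S(\tau,x;\mu_0)=(e^\tau-1)\sum_{j}\left(\frac{p_0^{(j)}-1}{1+(e^\tau-1)p_0^{(j)}}\right)p_0^{(j)}x^{(j)}e_j ,$$ the series being convergent in $H$. 4. For every $x$ in the domain of $C C_{\mu_0}^{-1}$, the score mismatch error $\bigl\|S(\tau,x;\mu_0)+C C_{\mu_0}^{-1}x\bigr\|_H^2$ tends to $0$ as $\tau\to0^+$. -/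

import Mathlib

open MeasureTheory ProbabilityTheory Filter Topology
open scoped NNReal ENNReal RealInnerProductSpace

namespace ScoreDiffusion

noncomputable section

section Operators

variable {H : Type*} [NormedAddCommGroup H] [InnerProductSpace ℝ H]

/-- A trace class, positive-definite, symmetric (bounded) operator. For a positive operator, being
trace class means that `∑ ⟪C vᵢ, vᵢ⟫` is finite along every orthonormal sequence `v`. -/
structure IsCovarianceOperator (C : H →L[ℝ] H) : Prop where
  isSymmetric : (C : H →ₗ[ℝ] H).IsSymmetric
  posDef : ∀ x : H, x ≠ 0 → 0 < ⟪C x, x⟫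
  traceClass : ∀ v : ℕ → H, Orthonormal ℝ v → Summable (fun i => ⟪C (v i), v i⟫)

/-- `R` is the (unique) positive square root `√C`. -/
structure IsPositiveSqrt (R C : H →L[ℝ] H) : Prop where
  isPositive : R.IsPositive
  sq_eq : R ∘L R = C

/-- The unbounded operator `C D⁻¹`: it is `D z ↦ C z` on the range of the injective operator `D`,
extended to its closure (as an operator, i.e. the graph is closed in `H × H`). -/
def quotientOperator (C D : H →L[ℝ] H) : H →ₗ.[ℝ] H :=
  ((C : H →ₗ[ℝ] H).compPMap (((D : H →ₗ[ℝ] H).toPMap ⊤).inverse)).closure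

end Operators

section Processes

variable {H : Type*} [NormedAddCommGroup H] [InnerProductSpace ℝ H]
  {Ω : Type*} [MeasurableSpace Ω]

/-- `W` is a cylindrical Wiener process on `H`; `W t h` is what is usually written `⟨W_t, h⟩`:
a centred Gaussian family with `Cov (W s h) (W t k) = min s t * ⟪h, k⟫` and continuous paths
in `t` for each direction `h`. -/
structure IsCylindricalWiener (W : ℝ≥0 → H → Ω → ℝ) (P : Measure Ω) : Prop where
  measurable : ∀ t h, Measurable (W t h)
  gaussian : IsGaussianProcess (fun q : ℝ≥0 × H => W q.1 q.2) P
  mean_zero : ∀ t h, ∫ ω, W t h ω ∂P = 0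
  covariance : ∀ s t h k, cov[W s h, W t k; P] = ((min s t : ℝ≥0) : ℝ) * ⟪h, k⟫
  continuous_paths : ∀ h, ∀ᵐ ω ∂P, Continuous (fun t => W t h ω)

/-- `I = ∫_0^τ f(s) dβ_s` for a continuous deterministic integrand `f` and a real process `β`:
`I` is the mean-square limit of the left-point Riemann sums over the uniform partitions. -/
def IsWienerIntegral (f : ℝ≥0 → ℝ) (β : ℝ≥0 → Ω → ℝ) (τ : ℝ≥0) (I : Ω → ℝ)
    (P : Measure Ω) : Prop :=
  Tendsto
    (fun n : ℕ => eLpNorm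
      (fun ω => (∑ i ∈ Finset.range n,
        f ((i : ℝ≥0) * τ / n) *
          (β (((i : ℝ≥0) + 1) * τ / n) ω - β ((i : ℝ≥0) * τ / n) ω)) - I ω) 2 P)
    atTop (𝓝 0)

/-- `J = ∫_0^τ f(s) R dW_s` as an `H`-valued random variable, for a symmetric operator `R`:
`⟨J, h⟩ = ∫_0^τ f(s) d⟨W_s, R h⟩` for every `h`. -/
def IsStochasticIntegral (f : ℝ≥0 → ℝ) (R : H →L[ℝ] H) (W : ℝ≥0 → H → Ω → ℝ) (τ : ℝ≥0)
    (J : Ω → H) (P : Measure Ω) : Prop :=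
  ∀ h : H, IsWienerIntegral f (fun t => W t (R h)) τ (fun ω => ⟪J ω, h⟫) P

variable [MeasurableSpace H]

/-- The forward diffusion `X_τ = e^{-τ/2} X_0 + ∫_0^τ e^{-(τ-s)/2} √C dW_s`, where `R = √C` and
the initial value `X_0` is independent of the cylindrical Wiener process `W`. -/
structure IsForwardDiffusion (R : H →L[ℝ] H) (W : ℝ≥0 → H → Ω → ℝ) (X : ℝ≥0 → Ω → H)
    (P : Measure Ω) : Prop where
  measurable : ∀ t, Measurable (X t)
  indep : IndepFun (X 0) (fun ω (q : ℝ≥0 × H) => W q.1 q.2 ω) P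
  eq_integral : ∀ τ : ℝ≥0, ∃ J : Ω → H,
    IsStochasticIntegral (fun s => Real.exp (-((τ : ℝ) - s) / 2)) R W τ J P ∧
      ∀ᵐ ω ∂P, X τ ω = Real.exp (-(τ : ℝ) / 2) • X 0 ω + J ω

variable [CompleteSpace H]

/-- `m` is a continuous version of the regression function `x ↦ E[X | Y = x]`. -/
def IsContinuousRegression (X Y : Ω → H) (P : Measure Ω) (m : H → H) : Prop :=
  Continuous m ∧
    (fun ω => m (Y ω)) =ᵐ[P] P[X | MeasurableSpace.comap Y inferInstance]

open scoped Classical in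
/-- `E[X | Y = x]` at the point `x`: the value at `x` of the continuous version of the regression
function (the zero function, if there is no continuous version). -/
def condMean (X Y : Ω → H) (P : Measure Ω) : H → H :=
  if hm : ∃ m, IsContinuousRegression X Y P m then hm.choose else 0

/-- The score `S(τ, x; μ₀) = -(1 - e^{-τ})⁻¹ (x - e^{-τ/2} E[X_0 | X_τ = x])`. -/
def score (X : ℝ≥0 → Ω → H) (P : Measure Ω) (τ : ℝ≥0) (x : H) : H :=
  -((1 - Real.exp (-(τ : ℝ)))⁻¹ •
      (x - Real.exp (-(τ : ℝ) / 2) • condMean (X 0) (X τ) P x))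

end Processes

end

end ScoreDiffusion

/-! Everything is diagonal in the common eigenbasis, so the theorem splits into scalar statements
and the estimates that let them be summed. Write `a = e^{-τ/2}`.

The pair `(X₀, X_τ)` is centred Gaussian. Its joint characteristic function
(`charFun_initial_add_state`) comes from approximating the stochastic integral by Riemann sums
independent of `X₀`. The diagonal operator `T` with entries `a μⱼ / (a² μⱼ + (1 - a²) λⱼ)` solves
the normal equation. Hence `X₀ - T X_τ` is independent of `X_τ` (`indepFun_residual`), and `T` is a
continuous version of the regression function. It is the only one: the law of `X_τ` charges every
nonempty open set (`isOpenPosMeasure_of_charFun_eq`), so continuous functions that agree almost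
surely coincide.

The closed operator `C Cμ⁻¹` multiplies the `j`-th coordinate by `pⱼ = λⱼ / μⱼ`, on the maximal
domain (`mem_graph_quotientOperator`). The mismatch formula is then the scalar `mismatch_identity`,
and its limit follows from dominated convergence in Parseval's sum, with a multiple of `‖C Cμ⁻¹ x‖²`
as majorant. -/

namespace ScoreDiffusion

/-! ### Diagonal operators and the closed quotient `C D⁻¹`. -/

section DiagonalOperators

variable {H : Type*} [NormedAddCommGroup H] [InnerProductSpace ℝ H]

/-- Two vectors with the same coordinates in a Hilbert basis are equal. -/
lemma ext_hilbertBasis (e : HilbertBasis ℕ ℝ H) {x y : H} (h : ∀ j, ⟪e j, x⟫ = ⟪e j, y⟫) :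
    x = y := by
  apply e.repr.injective
  ext j
  simp only [e.repr_apply_apply, h j]

/-- A symmetric operator acts diagonally on coordinates along an eigenbasis. -/
lemma inner_apply_of_eigenvector {C : H →L[ℝ] H} (hC : (C : H →ₗ[ℝ] H).IsSymmetric) {v : H}
    {c : ℝ} (hv : C v = c • v) (x : H) : ⟪v, C x⟫ = c * ⟪v, x⟫ := by
  have := hC v x
  simp only [ContinuousLinearMap.coe_coe, hv, real_inner_smul_left] at this
  exact this.symm

lemma eigenvalue_pos {C : H →L[ℝ] H} (hC : IsCovarianceOperator C) {v : H} (hv : ‖v‖ = 1) {c : ℝ}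
    (hc : C v = c • v) : 0 < c := by
  have h := hC.posDef v (by rintro rfl; simp at hv)
  simpa [hc, real_inner_smul_left, hv] using h

/-- Bounded diagonal operators exist. -/
lemma exists_diagonal (e : HilbertBasis ℕ ℝ H) {m : ℕ → ℝ} {M : ℝ} (hM : ∀ j, |m j| ≤ M) :
    ∃ T : H →L[ℝ] H, ∀ x j, ⟪e j, T x⟫ = m j * ⟪e j, x⟫ := by
  have hM0 : 0 ≤ M := (abs_nonneg _).trans (hM 0)
  have hb : ∀ (x : lp (fun _ : ℕ => ℝ) 2) j, ‖m j * x j‖ ≤ ‖(M • x) j‖ := fun x j => by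
    simp only [lp.coeFn_smul, Pi.smul_apply, norm_smul, norm_mul, Real.norm_eq_abs, abs_of_nonneg hM0]
    exact mul_le_mul_of_nonneg_right (hM j) (abs_nonneg _)
  have hmem : ∀ x : lp (fun _ : ℕ => ℝ) 2, Memℓp (fun j => m j * x j) 2 := fun x =>
    (lp.memℓp (M • x)).mono' (hb x)
  let D : lp (fun _ : ℕ => ℝ) 2 →ₗ[ℝ] lp (fun _ : ℕ => ℝ) 2 :=
    { toFun := fun x => ⟨fun j => m j * x j, hmem x⟩
      map_add' := fun x y => by ext j; simp only [lp.coeFn_add, Pi.add_apply, mul_add]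
      map_smul' := fun c x => by ext j; simp [mul_left_comm] }
  let D' : lp (fun _ : ℕ => ℝ) 2 →L[ℝ] lp (fun _ : ℕ => ℝ) 2 := D.mkContinuous M fun x => by
    refine (lp.norm_mono (by norm_num) (hb x)).trans ?_
    rw [norm_smul, Real.norm_eq_abs, abs_of_nonneg hM0]
  refine ⟨(e.repr.symm.toContinuousLinearEquiv : lp (fun _ : ℕ => ℝ) 2 →L[ℝ] H) ∘L D' ∘L
    (e.repr.toContinuousLinearEquiv : H →L[ℝ] lp (fun _ : ℕ => ℝ) 2), fun x j => ?_⟩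
  rw [← e.repr_apply_apply, ← e.repr_apply_apply]
  simp only [ContinuousLinearMap.coe_comp, Function.comp_apply, ContinuousLinearEquiv.coe_coe,
    LinearIsometryEquiv.coe_toContinuousLinearEquiv, LinearIsometryEquiv.apply_symm_apply]
  rfl

lemma isSymmetric_of_diagonal (e : HilbertBasis ℕ ℝ H) {m : ℕ → ℝ} {T : H →L[ℝ] H}
    (hT : ∀ x j, ⟪e j, T x⟫ = m j * ⟪e j, x⟫) : (T : H →ₗ[ℝ] H).IsSymmetric := by
  intro x y
  rw [ContinuousLinearMap.coe_coe, ← e.tsum_inner_mul_inner, ← e.tsum_inner_mul_inner]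
  refine tsum_congr fun j => ?_
  rw [hT, real_inner_comm, hT, real_inner_comm x]
  ring

lemma IsCovarianceOperator.eq_zero_of_apply_eq_zero {C : H →L[ℝ] H} (hC : IsCovarianceOperator C) {x : H}
    (hx : C x = 0) : x = 0 := by
  by_contra h
  simpa [hx] using hC.posDef x h

/-- Positive definiteness makes `D` injective, so `LinearPMap.inverse` is a genuine inverse here. -/
lemma mem_graph_quotient {C D : H →L[ℝ] H} (hD : IsCovarianceOperator D) {x y : H} :
    (x, y) ∈ ((C : H →ₗ[ℝ] H).compPMap (((D : H →ₗ[ℝ] H).toPMap ⊤).inverse)).graph ↔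
      ∃ z, D z = x ∧ C z = y := by
  have hker : LinearMap.ker ((D : H →ₗ[ℝ] H).toPMap ⊤).toFun = ⊥ := by
    rw [LinearMap.ker_eq_bot']
    rintro ⟨z, hz⟩ h
    exact Subtype.ext (hD.eq_zero_of_apply_eq_zero h)
  constructor
  · intro h
    obtain ⟨w, hw1, hw2⟩ := LinearPMap.mem_graph_iff _ |>.1 h
    have hw : (w : H) ∈ LinearMap.range ((D : H →ₗ[ℝ] H).toPMap ⊤).toFun := by
      rw [← LinearPMap.inverse_domain]; exact w.2
    obtain ⟨z, hz⟩ := hw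
    refine ⟨z, hz.trans hw1, ?_⟩
    refine Eq.trans ?_ hw2
    simp only [LinearMap.compPMap_apply]
    have h2 := LinearPMap.inverse_apply_eq hker (y := w) (x := z) hz
    change C z = C _
    exact congrArg C h2.symm
  · rintro ⟨z, rfl, rfl⟩
    rw [LinearPMap.mem_graph_iff]
    have hw : D z ∈ (((D : H →ₗ[ℝ] H).toPMap ⊤).inverse).domain := by
      rw [LinearPMap.inverse_domain]; exact ⟨⟨z, trivial⟩, rfl⟩
    refine ⟨⟨D z, hw⟩, rfl, ?_⟩
    have h2 := LinearPMap.inverse_apply_eq hker (y := ⟨D z, hw⟩) (x := ⟨z, trivial⟩) rfl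
    change C _ = C z
    exact congrArg C h2

lemma hasSum_hilbertBasis (e : HilbertBasis ℕ ℝ H) (x : H) :
    HasSum (fun j => ⟪x, e j⟫ • e j) x := by
  simpa only [e.repr_apply_apply, real_inner_comm] using e.hasSum_repr x

variable {C D : H →L[ℝ] H} {e : HilbertBasis ℕ ℝ H} {lam mu : ℕ → ℝ}

/-- The graph of `C D⁻¹` consists of the pairs whose coordinates are related by the ratios of the
eigenvalues. -/
lemma mem_graph_quotientOperator (hC : IsCovarianceOperator C) (hD : IsCovarianceOperator D)
    (hlam : ∀ j, C (e j) = lam j • e j) (hmu : ∀ j, D (e j) = mu j • e j) {x y : H} :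
    (x, y) ∈ (quotientOperator C D).graph ↔ ∀ j, ⟪e j, y⟫ = lam j / mu j * ⟪e j, x⟫ := by
  have hpos : ∀ j, 0 < mu j := fun j => eigenvalue_pos hD (e.orthonormal.1 j) (hmu j)
  set f := (C : H →ₗ[ℝ] H).compPMap (((D : H →ₗ[ℝ] H).toPMap ⊤).inverse) with hf
  -- The coordinate relation is a closed condition, so it survives passage to the closure; at `q.1 =
  -- 0` it forces `q.2 = 0`, which is closability.
  have hsub : ∀ q ∈ f.graph.topologicalClosure, ∀ j, ⟪e j, q.2⟫ = lam j / mu j * ⟪e j, q.1⟫ := by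
    intro q hq j
    have hcl : IsClosed {q : H × H | ⟪e j, q.2⟫ = lam j / mu j * ⟪e j, q.1⟫} :=
      isClosed_eq (by fun_prop) (by fun_prop)
    refine closure_minimal ?_ hcl hq
    rintro ⟨x, y⟩ hxy
    obtain ⟨z, rfl, rfl⟩ := (mem_graph_quotient hD).1 hxy
    simp only [Set.mem_ofPred_eq, inner_apply_of_eigenvector hC.isSymmetric (hlam j),
      inner_apply_of_eigenvector hD.isSymmetric (hmu j)]
    have := (hpos j).ne'
    field_simp
  have hclos : f.IsClosable := by
    refine ⟨f.graph.topologicalClosure.toLinearPMap, ?_⟩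
    rw [Submodule.toLinearPMap_graph_eq]
    intro q hq hq1
    refine ext_hilbertBasis e fun j => ?_
    rw [hsub q hq j, hq1]
    simp
  rw [quotientOperator, ← hf, ← hclos.graph_closure_eq_closure_graph]
  refine ⟨fun h => hsub _ h, fun h => ?_⟩
  -- Conversely, the partial sums of the expansions of `x` and `y` form pairs in the unclosed graph,
  -- and they converge to `(x, y)`.
  have hx := hasSum_hilbertBasis e x
  have hy := hasSum_hilbertBasis e y
  refine mem_closure_of_tendsto (Filter.Tendsto.prodMk_nhds hx hy)
    (Eventually.of_forall fun s => ?_)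
  refine (mem_graph_quotient hD).2 ⟨∑ j ∈ s, (⟪x, e j⟫ / mu j) • e j, ?_, ?_⟩
  · rw [map_sum]
    refine Finset.sum_congr rfl fun j _ => ?_
    rw [map_smul, hmu, smul_smul, div_mul_cancel₀ _ (hpos j).ne']
  · rw [map_sum]
    refine Finset.sum_congr rfl fun j _ => ?_
    rw [map_smul, hlam, smul_smul]
    simp only [real_inner_comm (e j)] at h ⊢
    rw [h j]
    congr 1
    ring

lemma inner_quotientOperator (hC : IsCovarianceOperator C) (hD : IsCovarianceOperator D)
    (hlam : ∀ j, C (e j) = lam j • e j) (hmu : ∀ j, D (e j) = mu j • e j)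
    (x : (quotientOperator C D).domain) (j : ℕ) :
    ⟪e j, quotientOperator C D x⟫ = lam j / mu j * ⟪e j, (x : H)⟫ :=
  (mem_graph_quotientOperator hC hD hlam hmu).1 (LinearPMap.mem_graph _ x) j

lemma domain_quotientOperator_eq_top (hC : IsCovarianceOperator C) (hD : IsCovarianceOperator D)
    (hlam : ∀ j, C (e j) = lam j • e j) (hmu : ∀ j, D (e j) = mu j • e j)
    (hbdd : BddAbove (Set.range fun j => lam j / mu j)) :
    (quotientOperator C D).domain = ⊤ := by
  obtain ⟨M, hM⟩ := hbdd
  have hp : ∀ j, 0 < lam j / mu j := fun j =>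
    div_pos (eigenvalue_pos hC (e.orthonormal.1 j) (hlam j))
      (eigenvalue_pos hD (e.orthonormal.1 j) (hmu j))
  obtain ⟨T, hT⟩ := exists_diagonal e (m := fun j => lam j / mu j) (M := M) fun j => by
    rw [abs_of_pos (hp j)]; exact hM ⟨j, rfl⟩
  refine eq_top_iff.2 fun x _ => ?_
  exact LinearPMap.mem_domain_of_mem_graph
    ((mem_graph_quotientOperator hC hD hlam hmu).2 fun j => hT x j)

end DiagonalOperators

/-! ### Riemann sums of the Wiener integral. -/

section WienerIntegrals

variable {H : Type*} [NormedAddCommGroup H] [InnerProductSpace ℝ H]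
  {Ω : Type*} [MeasurableSpace Ω] {P : Measure Ω}

/-- The left-point Riemann sum of `f` against `β` over the uniform partition of `[0, τ]` into `n`
intervals. -/
noncomputable def riemannSum (f : ℝ≥0 → ℝ) (β : ℝ≥0 → Ω → ℝ) (τ : ℝ≥0) (n : ℕ) (ω : Ω) : ℝ :=
  ∑ i ∈ Finset.range n,
    f ((i : ℝ≥0) * τ / n) * (β (((i : ℝ≥0) + 1) * τ / n) ω - β ((i : ℝ≥0) * τ / n) ω)

/-- Since `x ↦ e^{itx}` is `|t|`-Lipschitz, the two characteristic functions differ by at most `|t|`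
times the `L¹` distance, which the `L²` distance bounds. -/
lemma tendsto_charFun_map_of_tendsto_eLpNorm [IsProbabilityMeasure P] {Z : ℕ → Ω → ℝ}
    {Y : Ω → ℝ} (hZ : ∀ n, AEMeasurable (Z n) P) (hY : AEMeasurable Y P)
    (h : Tendsto (fun n => eLpNorm (fun ω => Z n ω - Y ω) 2 P) atTop (𝓝 0)) (t : ℝ) :
    Tendsto (fun n => charFun (P.map (Z n)) t) atTop (𝓝 (charFun (P.map Y) t)) := by
  have hint : ∀ {U : Ω → ℝ}, AEMeasurable U P →
      Integrable (fun ω => Complex.exp (t * U ω * Complex.I)) P := fun {U} hU => by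
    refine Integrable.of_bound (C := 1) (AEMeasurable.aestronglyMeasurable (by fun_prop))
      (Eventually.of_forall fun ω => ?_)
    rw [← Complex.ofReal_mul, Complex.norm_exp_ofReal_mul_I]
  have hchar : ∀ {U : Ω → ℝ}, AEMeasurable U P →
      charFun (P.map U) t = ∫ ω, Complex.exp (t * U ω * Complex.I) ∂P := fun {U} hU => by
    rw [charFun_apply_real, integral_map hU (by fun_prop)]
  have hbound : ∀ x y : ℝ,
      ‖Complex.exp (t * x * Complex.I) - Complex.exp (t * y * Complex.I)‖ₑ ≤
        ‖t‖ₑ * ‖x - y‖ₑ := fun x y => by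
    have : Complex.exp (t * x * Complex.I) - Complex.exp (t * y * Complex.I) =
        Complex.exp ((t * y : ℝ) * Complex.I) *
          (Complex.exp (Complex.I * (t * (x - y) : ℝ)) - 1) := by
      rw [mul_sub, ← Complex.exp_add]
      push_cast
      ring_nf
    rw [this, enorm_mul]
    have h1 : ‖Complex.exp ((t * y : ℝ) * Complex.I)‖ₑ = 1 := by
      rw [← ofReal_norm, Complex.norm_exp_ofReal_mul_I, ENNReal.ofReal_one]
    rw [h1, one_mul, ← enorm_mul]
    exact Real.enorm_exp_I_mul_ofReal_sub_one_le
  rw [tendsto_iff_edist_tendsto_0]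
  refine tendsto_of_tendsto_of_tendsto_of_le_of_le tendsto_const_nhds
    (by simpa using ENNReal.Tendsto.const_mul h (Or.inr (enorm_ne_top (x := t)))) (fun _ => zero_le)
    fun n => ?_
  rw [edist_eq_enorm_sub, hchar (hZ n), hchar hY, ← integral_sub (hint (hZ n)) (hint hY)]
  calc _ ≤ ∫⁻ ω, ‖Complex.exp (t * Z n ω * Complex.I) - Complex.exp (t * Y ω * Complex.I)‖ₑ ∂P :=
        enorm_integral_le_lintegral_enorm _
    _ ≤ ∫⁻ ω, ‖t‖ₑ * ‖Z n ω - Y ω‖ₑ ∂P := lintegral_mono fun ω => hbound _ _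
    _ = ‖t‖ₑ * eLpNorm (fun ω => Z n ω - Y ω) 1 P := by
        rw [lintegral_const_mul' _ _ enorm_ne_top, eLpNorm_one_eq_lintegral_enorm]
    _ ≤ _ := by
        gcongr
        exact eLpNorm_le_eLpNorm_of_exponent_le (by norm_num)
          ((hZ n).sub hY).aestronglyMeasurable

variable {W : ℝ≥0 → H → Ω → ℝ}

lemma IsCylindricalWiener.memLp (hW : IsCylindricalWiener W P) (t : ℝ≥0) (k : H) :
    MemLp (W t k) 2 P :=
  (hW.gaussian.hasGaussianLaw_eval (t, k)).memLp_two

lemma IsCylindricalWiener.covariance_increments [IsProbabilityMeasure P]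
    (hW : IsCylindricalWiener W P) (k : H) {s t u v : ℝ≥0} (hst : s ≤ t) (htu : t ≤ u)
    (huv : u ≤ v) :
    cov[fun ω => W t k ω - W s k ω, fun ω => W v k ω - W u k ω; P] = 0 := by
  rw [covariance_fun_sub_fun_sub (hW.memLp _ _) (hW.memLp _ _) (hW.memLp _ _) (hW.memLp _ _)]
  simp only [hW.covariance]
  rw [min_eq_left (htu.trans huv), min_eq_left htu, min_eq_left (hst.trans (htu.trans huv)),
    min_eq_left (hst.trans htu)]
  ring

lemma IsCylindricalWiener.covariance_increment_self [IsProbabilityMeasure P]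
    (hW : IsCylindricalWiener W P) (k : H) {s t : ℝ≥0} (hst : s ≤ t) :
    cov[fun ω => W t k ω - W s k ω, fun ω => W t k ω - W s k ω; P] =
      ((t : ℝ) - s) * ‖k‖ ^ 2 := by
  rw [covariance_fun_sub_fun_sub (hW.memLp _ _) (hW.memLp _ _) (hW.memLp _ _) (hW.memLp _ _)]
  simp only [hW.covariance, real_inner_self_eq_norm_sq, min_self]
  rw [min_eq_left hst, min_eq_right hst]
  ring

lemma IsCylindricalWiener.measurable_riemannSum (hW : IsCylindricalWiener W P) (f : ℝ≥0 → ℝ)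
    (k : H) (τ : ℝ≥0) (n : ℕ) : Measurable (riemannSum f (fun t => W t k) τ n) :=
  Finset.measurable_sum _ fun _ _ =>
    ((hW.measurable _ _).sub (hW.measurable _ _)).const_mul _

lemma IsCylindricalWiener.hasGaussianLaw_riemannSum (hW : IsCylindricalWiener W P) (f : ℝ≥0 → ℝ)
    (k : H) (τ : ℝ≥0) (n : ℕ) : HasGaussianLaw (riemannSum f (fun t => W t k) τ n) P := by
  have h := hW.gaussian.hasGaussianLaw_increments (n := n)
    (t := fun i => ((((i : ℕ) : ℝ≥0) * τ / n, k) : ℝ≥0 × H))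
  let L : (Fin n → ℝ) →L[ℝ] ℝ :=
    ∑ i : Fin n, f (((i : ℕ) : ℝ≥0) * τ / n) • ContinuousLinearMap.proj i
  convert! h.map L
  ext ω
  simp [riemannSum, L, Finset.sum_range]

lemma IsCylindricalWiener.integral_riemannSum [IsProbabilityMeasure P]
    (hW : IsCylindricalWiener W P) (f : ℝ≥0 → ℝ) (k : H) (τ : ℝ≥0) (n : ℕ) :
    ∫ ω, riemannSum f (fun t => W t k) τ n ω ∂P = 0 := by
  have hint : ∀ t, Integrable (W t k) P := fun t => (hW.memLp t k).integrable (by norm_num)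
  simp only [riemannSum]
  rw [integral_finsetSum _ fun i _ => by
    simpa only [Pi.sub_apply] using ((hint _).sub (hint _)).const_mul _]
  refine Finset.sum_eq_zero fun i _ => ?_
  rw [integral_const_mul, integral_sub (hint _) (hint _), hW.mean_zero, hW.mean_zero]
  simp

/-- Increments over disjoint intervals are uncorrelated, so only the diagonal terms of the double
sum remain. -/
lemma IsCylindricalWiener.variance_riemannSum [IsProbabilityMeasure P]
    (hW : IsCylindricalWiener W P) (f : ℝ≥0 → ℝ) (k : H) (τ : ℝ≥0) (n : ℕ) :
    Var[riemannSum f (fun t => W t k) τ n; P] =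
      (∑ i ∈ Finset.range n, f ((i : ℝ≥0) * τ / n) ^ 2 * (τ / n)) * ‖k‖ ^ 2 := by
  have hmono : Monotone fun i : ℕ => (i : ℝ≥0) * τ / n := fun i j hij => by
    dsimp only
    gcongr
  have hstep : ∀ i : ℕ, ((i : ℝ≥0) + 1) * τ / n = ((i + 1 : ℕ) : ℝ≥0) * τ / n := fun i => by
    push_cast; rfl
  have hmem : ∀ i : ℕ, MemLp (fun ω => f ((i : ℝ≥0) * τ / n) *
      (W (((i : ℝ≥0) + 1) * τ / n) k ω - W ((i : ℝ≥0) * τ / n) k ω)) 2 P := fun i =>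
    ((hW.memLp _ _).sub (hW.memLp _ _)).const_mul _
  unfold riemannSum
  rw [variance_fun_sum' fun i _ => hmem i, Finset.sum_mul]
  refine Finset.sum_congr rfl fun i hi => ?_
  rw [Finset.sum_eq_single_of_mem i hi]
  · rw [covariance_const_mul_left, covariance_const_mul_right, hstep,
      hW.covariance_increment_self k (hmono (Nat.le_succ i))]
    push_cast
    ring
  · intro j _ hji
    rw [covariance_const_mul_left, covariance_const_mul_right, hstep, hstep]
    rcases lt_or_gt_of_ne hji with hlt | hlt
    · rw [covariance_comm, hW.covariance_increments k (hmono (Nat.le_succ j))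
        (hmono (Nat.succ_le_of_lt hlt)) (hmono (Nat.le_succ i))]
      simp
    · rw [hW.covariance_increments k (hmono (Nat.le_succ i))
        (hmono (Nat.succ_le_of_lt hlt)) (hmono (Nat.le_succ j))]
      simp

lemma IsCylindricalWiener.charFun_riemannSum [IsProbabilityMeasure P]
    (hW : IsCylindricalWiener W P) (f : ℝ≥0 → ℝ) (k : H) (τ : ℝ≥0) (n : ℕ) :
    charFun (P.map (riemannSum f (fun t => W t k) τ n)) 1 =
      Complex.exp (-(((∑ i ∈ Finset.range n, f ((i : ℝ≥0) * τ / n) ^ 2 * (τ / n)) * ‖k‖ ^ 2 : ℝ)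
        : ℂ) / 2) := by
  rw [(hW.hasGaussianLaw_riemannSum f k τ n).charFun_map_eq, ← hW.variance_riemannSum]
  have h : ∀ x : ℝ, ⟪(1 : ℝ), x⟫ = x := fun x => by simp
  simp only [h]
  rw [hW.integral_riemannSum]
  simp [neg_div]

/-- The quadratic variation sums of the exponential integrand converge. -/
lemma tendsto_sum_exp_sq {τ : ℝ≥0} (hτ : 0 < τ) :
    Tendsto (fun n : ℕ => ∑ i ∈ Finset.range n,
      Real.exp (-((τ : ℝ) - (((i : ℝ≥0) * τ / n : ℝ≥0) : ℝ)) / 2) ^ 2 * ((τ : ℝ) / n)) atTop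
      (𝓝 (1 - Real.exp (-(τ : ℝ)))) := by
  have hτ' : (0 : ℝ) < τ := hτ
  -- The sum is geometric with ratio `e^{τ/n}`; in its closed form the only quantity depending on
  -- `n` is this difference quotient of `exp` at `0`.
  have hslope : Tendsto (fun n : ℕ => (Real.exp (τ / n) - 1) / ((τ : ℝ) / n)) atTop (𝓝 1) := by
    have h := (hasDerivAt_iff_tendsto_slope.1 (Real.hasDerivAt_exp 0))
    rw [Real.exp_zero] at h
    have h0 : Tendsto (fun n : ℕ => (τ : ℝ) / n) atTop (𝓝[≠] 0) := by
      refine tendsto_nhdsWithin_iff.2 ⟨tendsto_const_div_atTop_nhds_zero_nat _, ?_⟩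
      filter_upwards [eventually_gt_atTop 0] with n hn
      have : (0 : ℝ) < n := by exact_mod_cast hn
      exact (div_pos hτ' this).ne'
    refine (h.comp h0).congr fun n => ?_
    simp [slope_def_field]
  have hlim : Tendsto (fun n : ℕ => Real.exp (-(τ : ℝ)) * (Real.exp τ - 1) /
      ((Real.exp (τ / n) - 1) / ((τ : ℝ) / n))) atTop (𝓝 (1 - Real.exp (-(τ : ℝ)))) := by
    have := (tendsto_const_nhds (x := Real.exp (-(τ : ℝ)) * (Real.exp τ - 1))).div hslope one_ne_zero
    simp only [Pi.div_def] at this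
    convert this using 2
    rw [div_one, mul_sub, ← Real.exp_add]
    simp
  refine hlim.congr' ?_
  filter_upwards [eventually_gt_atTop 0] with n hn
  have hn' : (0 : ℝ) < n := by exact_mod_cast hn
  have hq : Real.exp ((τ : ℝ) / n) ≠ 1 := by
    rw [Ne, Real.exp_eq_one_iff]; positivity
  have hterm : ∀ i : ℕ, Real.exp (-((τ : ℝ) - (((i : ℝ≥0) * τ / n : ℝ≥0) : ℝ)) / 2) ^ 2 *
      ((τ : ℝ) / n) = Real.exp (-(τ : ℝ)) * (τ / n) * Real.exp ((τ : ℝ) / n) ^ i := fun i => by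
    rw [← Real.exp_nat_mul, ← Real.exp_nat_mul, mul_right_comm, ← Real.exp_add]
    push_cast
    ring_nf
  have hqn : Real.exp ((τ : ℝ) / n) ^ n = Real.exp τ := by
    rw [← Real.exp_nat_mul, mul_div_cancel₀ _ hn'.ne']
  rw [Finset.sum_congr rfl fun i _ => hterm i, ← Finset.mul_sum, geom_sum_eq hq, hqn]
  have := sub_ne_zero.2 hq
  field_simp

end WienerIntegrals

/-! ### Centred Gaussian measures: independence of coordinates and full support. -/

section CenteredGaussian

variable {H : Type*} [NormedAddCommGroup H] [InnerProductSpace ℝ H] [MeasurableSpace H]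
  [BorelSpace H]

lemma charFun_map_inner {Ω : Type*} [MeasurableSpace Ω] {P : Measure Ω}
    [SecondCountableTopology H] {Y : Ω → H}
    (hY : AEMeasurable Y P) (u : H) :
    charFun (P.map fun ω => ⟪u, Y ω⟫) 1 = charFun (P.map Y) u := by
  rw [charFun_apply_real, charFun_apply, integral_map (by fun_prop) (by fun_prop),
    integral_map hY (by fun_prop)]
  simp only [real_inner_comm u, Complex.ofReal_one, one_mul]

variable {ν : Measure H} {K : H →L[ℝ] H}

lemma map_coordinate_eq_gaussianReal [IsFiniteMeasure ν] [SecondCountableTopology H]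
    (hν : ∀ t, charFun ν t = Complex.exp (-(⟪K t, t⟫ : ℝ) / 2)) {v : H} (hv : ‖v‖ = 1) {κ : ℝ≥0}
    (hκ : K v = (κ : ℝ) • v) : ν.map (fun x => ⟪v, x⟫) = gaussianReal 0 κ := by
  refine Measure.ext_of_charFun (funext fun t => ?_)
  have h2 : charFun (ν.map fun x => ⟪v, x⟫) t = charFun ν (t • v) := by
    rw [charFun_apply, charFun_apply, integral_map (by fun_prop) (by fun_prop)]
    refine integral_congr_ae (Eventually.of_forall fun x => ?_)
    simp [real_inner_smul_right, real_inner_comm x v, mul_comm]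
  rw [h2, hν, charFun_gaussianReal]
  simp only [map_smul, hκ, real_inner_smul_left, real_inner_smul_right, real_inner_self_eq_norm_sq,
    hv]
  push_cast
  ring_nf

variable [CompleteSpace H]

lemma isGaussian_of_charFun_eq [IsFiniteMeasure ν] [SecondCountableTopology H]
    (hK : K.IsPositive)
    (hν : ∀ t, charFun ν t = Complex.exp (-(⟪K t, t⟫ : ℝ) / 2)) : IsGaussian ν := by
  refine isGaussian_iff_gaussian_charFun.2 ⟨0, (innerSL ℝ) ∘L K, ⟨⟨fun x y => ?_⟩, ⟨fun x => ?_⟩⟩,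
    fun t => ?_⟩
  · change ⟪K x, y⟫ = ⟪K y, x⟫
    exact (hK.isSymmetric x y).trans (real_inner_comm _ _)
  · exact hK.inner_nonneg_left x
  · change _ = Complex.exp (_ - (⟪K t, t⟫ : ℝ) / 2)
    rw [hν]
    simp [neg_div]

/-- The characteristic function is even, so `ν` is invariant under `x ↦ -x` and its mean equals its
own negative. -/
lemma integral_eq_zero_of_charFun_eq [IsFiniteMeasure ν] [SecondCountableTopology H]
    (hν : ∀ t, charFun ν t = Complex.exp (-(⟪K t, t⟫ : ℝ) / 2)) : ∫ x, x ∂ν = 0 := by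
  have h : ν.map (fun x => -x) = ν := by
    refine Measure.ext_of_charFun (funext fun t => ?_)
    rw [hν, charFun_apply, integral_map (by fun_prop) (by fun_prop)]
    have := hν (-t)
    rw [charFun_apply] at this
    simpa using this
  have h2 : ∫ x, x ∂(ν.map (fun x => -x)) = -∫ x, x ∂ν := by
    rw [integral_map (by fun_prop) (by fun_prop), integral_neg]
  rw [h] at h2
  have h3 : (2 : ℝ) • ∫ x, x ∂ν = 0 := by
    rw [two_smul]
    nth_rewrite 1 [h2]
    exact neg_add_cancel _
  simpa using h3

lemma charFun_eq_of_covarianceOperator [IsGaussian ν] [SecondCountableTopology H]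
    (hmean : ∫ x, x ∂ν = 0) (hcov : covarianceOperator ν = K) (t : H) :
    charFun ν t = Complex.exp (-(⟪K t, t⟫ : ℝ) / 2) := by
  have hmem : MemLp id 2 ν := IsGaussian.memLp_two_id
  have hint : Integrable (fun x : H => x) ν := IsGaussian.integrable_id
  have h0 : ∫ x, ⟪t, x⟫ ∂ν = 0 := by rw [integral_inner hint, hmean, inner_zero_right]
  rw [IsGaussian.charFun_eq, integral_complex_ofReal, h0,
    variance_of_integral_eq_zero (by fun_prop) h0, ← hcov, covarianceOperator_inner hmem]
  simp [neg_div, sq]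

/-- For an eigenvector `v` of the symmetric `K`, the line through `v` and its orthogonal complement
are `K`-orthogonal: the quadratic form splits and the characteristic function factors. -/
lemma indepFun_coordinate [IsFiniteMeasure ν] [SecondCountableTopology H]
    (hK : (K : H →ₗ[ℝ] H).IsSymmetric)
    (hν : ∀ t, charFun ν t = Complex.exp (-(⟪K t, t⟫ : ℝ) / 2)) {v : H} (hv : ‖v‖ = 1) {κ : ℝ}
    (hκ : K v = κ • v) :
    IndepFun (fun x => ⟪v, x⟫) (fun x => x - ⟪v, x⟫ • v) ν := by
  have hvv : ⟪v, v⟫ = 1 := by rw [real_inner_self_eq_norm_sq, hv, one_pow]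
  rw [indepFun_iff_charFun_prod (by fun_prop) (by fun_prop)]
  intro t
  have hproj : ∀ x w : H, ⟪x - ⟪v, x⟫ • v, w⟫ = ⟪x, w - ⟪v, w⟫ • v⟫ := fun x w => by
    simp only [inner_sub_left, inner_sub_right, real_inner_smul_left, real_inner_smul_right]
    rw [real_inner_comm v x]
    ring
  have h1 : charFun (ν.map fun x => WithLp.toLp 2 (⟪v, x⟫, x - ⟪v, x⟫ • v)) t =
      charFun ν (t.ofLp.1 • v + (t.ofLp.2 - ⟪v, t.ofLp.2⟫ • v)) := by
    rw [charFun_apply, charFun_apply, integral_map (by fun_prop) (by fun_prop)]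
    refine integral_congr_ae (Eventually.of_forall fun x => ?_)
    simp only [WithLp.prod_inner_apply, hproj, inner_add_right, real_inner_smul_right]
    rw [real_inner_comm x v]
    simp
  have h2 : charFun (ν.map fun x => ⟪v, x⟫) t.ofLp.1 = charFun ν (t.ofLp.1 • v) := by
    rw [charFun_apply, charFun_apply, integral_map (by fun_prop) (by fun_prop)]
    refine integral_congr_ae (Eventually.of_forall fun x => ?_)
    simp [real_inner_smul_right, real_inner_comm x v, mul_comm]
  have h3 : charFun (ν.map fun x => x - ⟪v, x⟫ • v) t.ofLp.2 =
      charFun ν (t.ofLp.2 - ⟪v, t.ofLp.2⟫ • v) := by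
    rw [charFun_apply, charFun_apply, integral_map (by fun_prop) (by fun_prop)]
    simp only [hproj]
  rw [h1, h2, h3, hν, hν, hν, ← Complex.exp_add]
  set w := t.ofLp.2 - ⟪v, t.ofLp.2⟫ • v with hw
  have hvw : ⟪v, w⟫ = 0 := by rw [hw, inner_sub_right, real_inner_smul_right, hvv]; ring
  have hKw : ⟪K w, v⟫ = 0 := by
    have := hK w v
    simp only [ContinuousLinearMap.coe_coe] at this
    rw [this, hκ, real_inner_smul_right, real_inner_comm, hvw, mul_zero]
  have : ⟪K (t.ofLp.1 • v + w), t.ofLp.1 • v + w⟫ =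
      ⟪K (t.ofLp.1 • v), t.ofLp.1 • v⟫ + ⟪K w, w⟫ := by
    simp only [map_add, map_smul, inner_add_left, inner_add_right, real_inner_smul_left,
      real_inner_smul_right, hκ, hvw, hKw]
    ring
  rw [this]
  push_cast
  ring_nf

/-- A null open set of a centered Gaussian measure stays null when it is enlarged in the direction
of an eigenvector of the covariance. -/
lemma measure_setOf_exists_add_smul_mem_eq_zero [IsFiniteMeasure ν] [SecondCountableTopology H]
    (hK : (K : H →ₗ[ℝ] H).IsSymmetric)
    (hν : ∀ t, charFun ν t = Complex.exp (-(⟪K t, t⟫ : ℝ) / 2)) {v : H} (hv : ‖v‖ = 1) {κ : ℝ}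
    (hκ : K v = κ • v) (hκ0 : 0 < κ) {U : Set H} (hU : IsOpen U) (hU0 : ν U = 0) :
    ν {x | ∃ c : ℝ, x + c • v ∈ U} = 0 := by
  lift κ to ℝ≥0 using hκ0.le
  have hind := (indepFun_coordinate hK hν hv hκ).symm
  rw [indepFun_iff_map_prod_eq_prod_map_map (by fun_prop) (by fun_prop),
    map_coordinate_eq_gaussianReal hν hv hκ] at hind
  have hae : ∀ᵐ p ∂(ν.map fun x => (x - ⟪v, x⟫ • v, ⟪v, x⟫)), p.1 + p.2 • v ∉ U := by
    have hms : MeasurableSet {p : H × ℝ | p.1 + p.2 • v ∉ U} :=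
      (hU.isClosed_compl.preimage (by fun_prop : Continuous fun p : H × ℝ =>
        p.1 + p.2 • v)).measurableSet
    rw [ae_map_iff (by fun_prop) hms]
    simpa using measure_eq_zero_iff_ae_notMem.1 hU0
  rw [hind] at hae
  -- By Fubini almost every slice of `U` along `v` is null for a nondegenerate Gaussian, hence
  -- Lebesgue null. Slices are open, so a null one is empty.
  have hae2 := Measure.ae_ae_of_ae_prod hae
  have hae3 := ae_of_ae_map (by fun_prop) hae2
  rw [measure_eq_zero_iff_ae_notMem]
  filter_upwards [hae3] with x hx
  rintro ⟨c, hc⟩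
  have hκ' : κ ≠ 0 := by rintro rfl; simp at hκ0
  have hvol := gaussianReal_absolutelyContinuous' 0 hκ' hx
  have hopen : IsOpen {r : ℝ | x - ⟪v, x⟫ • v + r • v ∈ U} := hU.preimage (by fun_prop)
  have hpos := hopen.measure_pos volume ⟨⟪v, x⟫ + c, by
    simpa [add_smul, ← add_assoc] using hc⟩
  refine hpos.ne' ?_
  simpa [Set.compl_def] using hvol

/-- A centered Gaussian measure charges every nonempty open set if its covariance has an
orthonormal basis of eigenvectors with positive eigenvalues. -/
lemma isOpenPosMeasure_of_charFun_eq [IsProbabilityMeasure ν] [SecondCountableTopology H]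
    (hK : (K : H →ₗ[ℝ] H).IsSymmetric)
    (hν : ∀ t, charFun ν t = Complex.exp (-(⟪K t, t⟫ : ℝ) / 2)) (e : HilbertBasis ℕ ℝ H)
    {κ : ℕ → ℝ} (hκ : ∀ j, K (e j) = κ j • e j) (hκ0 : ∀ j, 0 < κ j) :
    ν.IsOpenPosMeasure := by
  refine ⟨fun U hU hne hU0 => ?_⟩
  -- `V n` is `U` enlarged by the span of the first `n` basis vectors. Each is null if `U` is, yet
  -- they cover `H`: from any `x`, partial sums of `u - x` lead into a neighbourhood of `u ∈ U`.
  let V : ℕ → Set H := fun n => Nat.rec U (fun n A => {x | ∃ c : ℝ, x + c • e n ∈ A}) n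
  have hV : ∀ n, IsOpen (V n) ∧ ν (V n) = 0 := by
    intro n
    induction n with
    | zero => exact ⟨hU, hU0⟩
    | succ n ih =>
      refine ⟨?_, measure_setOf_exists_add_smul_mem_eq_zero hK hν (e.orthonormal.1 n) (hκ n)
        (hκ0 n) ih.1 ih.2⟩
      have : V (n + 1) = ⋃ c : ℝ, (fun x => x + c • e n) ⁻¹' V n := by
        ext x; simp [V]
      rw [this]
      exact isOpen_iUnion fun c => ih.1.preimage (by fun_prop)
  have hmem : ∀ (n : ℕ) (c : ℕ → ℝ) (x : H), x + ∑ j ∈ Finset.range n, c j • e j ∈ U → x ∈ V n := by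
    intro n c
    induction n with
    | zero => intro x hx; simpa [V] using hx
    | succ n ih =>
      intro x hx
      refine ⟨c n, ih _ ?_⟩
      rwa [Finset.sum_range_succ, add_comm (∑ j ∈ _, _), ← add_assoc] at hx
  have huniv : (⋃ n, V n) = Set.univ := by
    refine Set.eq_univ_of_forall fun x => ?_
    obtain ⟨u, hu⟩ := hne
    have hlim : Tendsto (fun n => x + ∑ j ∈ Finset.range n, ⟪u - x, e j⟫ • e j) atTop (𝓝 u) := by
      have := ((hasSum_hilbertBasis e (u - x)).tendsto_sum_nat).const_add x
      simpa using this
    obtain ⟨n, hn⟩ := (hlim.eventually (hU.mem_nhds hu)).exists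
    exact Set.mem_iUnion.2 ⟨n, hmem n _ x hn⟩
  have h0 : ν Set.univ = 0 := by
    rw [← huniv]
    exact measure_iUnion_null fun n => (hV n).2
  simp at h0

end CenteredGaussian

/-! ### Joint law of `(X₀, X_τ)` and the linear regression. -/

section Regression

lemma IsPositiveSqrt.norm_sq_apply {H : Type*} [NormedAddCommGroup H]
    [InnerProductSpace ℝ H] {R C : H →L[ℝ] H} (hR : IsPositiveSqrt R C) (x : H) :
    ‖R x‖ ^ 2 = ⟪C x, x⟫ := by
  rw [← real_inner_self_eq_norm_sq, ← hR.sq_eq]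
  exact (hR.isPositive.isSymmetric (R x) x).symm

variable {H : Type*} [NormedAddCommGroup H] [InnerProductSpace ℝ H]
  [SecondCountableTopology H] [MeasurableSpace H] [BorelSpace H]
  {C Cμ R T : H →L[ℝ] H} {Ω : Type*} [MeasurableSpace Ω] {P : Measure Ω}
  {W : ℝ≥0 → H → Ω → ℝ} {X : ℝ≥0 → Ω → H} {τ : ℝ≥0}

/-- For Riemann sums in place of `J` the characteristic function factors by independence. The
mean-square limit then gives the claim, with the limit of the variances playing the role of the Itô
isometry. -/
lemma charFun_initial_add_noise [IsProbabilityMeasure P] (hR : IsPositiveSqrt R C)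
    (hW : IsCylindricalWiener W P)
    (hX0 : Measurable (X 0)) (hind : IndepFun (X 0) (fun ω (q : ℝ≥0 × H) => W q.1 q.2 ω) P)
    (hlaw : ∀ t, charFun (P.map (X 0)) t = Complex.exp (-(⟪Cμ t, t⟫ : ℝ) / 2))
    (hτ : 0 < τ) {J : Ω → H} (hJm : AEMeasurable J P)
    (hJ : IsStochasticIntegral (fun s => Real.exp (-((τ : ℝ) - s) / 2)) R W τ J P) (u v : H) :
    charFun (P.map fun ω => ⟪u, X 0 ω⟫ + ⟪v, J ω⟫) 1 =
      Complex.exp (-(⟪Cμ u, u⟫ + (1 - Real.exp (-(τ : ℝ))) * ⟪C v, v⟫ : ℝ) / 2) := by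
  set f : ℝ≥0 → ℝ := fun s => Real.exp (-((τ : ℝ) - s) / 2) with hf
  have hS := hW.measurable_riemannSum f (R v) τ
  have hsum : ∀ n : ℕ, charFun (P.map fun ω => ⟪u, X 0 ω⟫ +
      riemannSum f (fun t => W t (R v)) τ n ω) 1 =
      Complex.exp (-(⟪Cμ u, u⟫ : ℝ) / 2) * Complex.exp (-(((∑ i ∈ Finset.range n,
        f ((i : ℝ≥0) * τ / n) ^ 2 * (τ / n)) * ‖R v‖ ^ 2 : ℝ) : ℂ) / 2) := fun n => by
    have hI : IndepFun (fun ω => ⟪u, X 0 ω⟫) (riemannSum f (fun t => W t (R v)) τ n) P := by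
      -- The Riemann sum reads finitely many coordinates of `W`, so it inherits independence from `X
      -- 0`.
      have hφ : Measurable fun g : ℝ≥0 × H → ℝ => ∑ i ∈ Finset.range n,
          f ((i : ℝ≥0) * τ / n) *
            (g (((i : ℝ≥0) + 1) * τ / n, R v) - g ((i : ℝ≥0) * τ / n, R v)) := by fun_prop
      exact hind.comp (φ := fun x => ⟪u, x⟫) (by fun_prop) hφ
    rw [hI.charFun_map_fun_add_eq_mul (by fun_prop) (hS n).aemeasurable, Pi.mul_apply,
      charFun_map_inner hX0.aemeasurable, hlaw, hW.charFun_riemannSum]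
  have hlim1 := tendsto_charFun_map_of_tendsto_eLpNorm (P := P)
    (Z := fun n ω => ⟪u, X 0 ω⟫ + riemannSum f (fun t => W t (R v)) τ n ω)
    (Y := fun ω => ⟪u, X 0 ω⟫ + ⟪v, J ω⟫)
    (fun n => ((hX0.const_inner).add (hS n)).aemeasurable) (by fun_prop)
    (by
      have := hJ v
      unfold IsWienerIntegral at this
      simpa only [add_sub_add_left_eq_sub, real_inner_comm v, riemannSum] using this) 1
  refine tendsto_nhds_unique hlim1 ?_
  simp only [hsum]
  have hlim2 := tendsto_sum_exp_sq hτ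
  have hlim3 : Tendsto (fun n : ℕ => ((∑ i ∈ Finset.range n,
        f ((i : ℝ≥0) * τ / n) ^ 2 * ((τ : ℝ) / n)) * ‖R v‖ ^ 2)) atTop
      (𝓝 ((1 - Real.exp (-(τ : ℝ))) * ⟪C v, v⟫)) := by
    rw [← hR.norm_sq_apply]
    exact hlim2.mul_const _
  have hcont : Continuous fun r : ℝ => Complex.exp (-(⟪Cμ u, u⟫ : ℝ) / 2) *
      Complex.exp (-(r : ℂ) / 2) := by fun_prop
  have heq : Complex.exp (-(⟪Cμ u, u⟫ + (1 - Real.exp (-(τ : ℝ))) * ⟪C v, v⟫ : ℝ) / 2) =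
      Complex.exp (-(⟪Cμ u, u⟫ : ℝ) / 2) *
        Complex.exp (-(((1 - Real.exp (-(τ : ℝ))) * ⟪C v, v⟫ : ℝ) : ℂ) / 2) := by
    rw [← Complex.exp_add]
    push_cast
    ring_nf
  rw [heq]
  exact (hcont.tendsto _).comp hlim3

lemma charFun_initial_add_state [IsProbabilityMeasure P] (hR : IsPositiveSqrt R C)
    (hW : IsCylindricalWiener W P) (hX : IsForwardDiffusion R W X P)
    (hlaw : ∀ t, charFun (P.map (X 0)) t = Complex.exp (-(⟪Cμ t, t⟫ : ℝ) / 2))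
    (hτ : 0 < τ) (u v : H) :
    charFun (P.map fun ω => ⟪u, X 0 ω⟫ + ⟪v, X τ ω⟫) 1 =
      Complex.exp (-(⟪Cμ (u + Real.exp (-(τ : ℝ) / 2) • v), u + Real.exp (-(τ : ℝ) / 2) • v⟫ +
        (1 - Real.exp (-(τ : ℝ))) * ⟪C v, v⟫ : ℝ) / 2) := by
  obtain ⟨J, hJ, hXJ⟩ := hX.eq_integral τ
  have hX0 := hX.measurable 0
  have hXτ := hX.measurable τ
  -- Measurability of `J` is not part of its definition; it is recovered from `X τ` and `X 0`.
  have hJm : AEMeasurable J P := by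
    refine AEMeasurable.congr (f := fun ω => X τ ω - Real.exp (-(τ : ℝ) / 2) • X 0 ω)
      (by fun_prop) ?_
    filter_upwards [hXJ] with ω hω
    rw [hω, add_sub_cancel_left]
  rw [← charFun_initial_add_noise hR hW hX0 hX.indep hlaw hτ hJm hJ]
  congr 1
  refine Measure.map_congr ?_
  filter_upwards [hXJ] with ω hω
  rw [hω, inner_add_right, inner_add_left, real_inner_smul_left, real_inner_smul_right, add_assoc]

lemma charFun_state [IsProbabilityMeasure P] (hR : IsPositiveSqrt R C)
    (hW : IsCylindricalWiener W P) (hX : IsForwardDiffusion R W X P)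
    (hlaw : ∀ t, charFun (P.map (X 0)) t = Complex.exp (-(⟪Cμ t, t⟫ : ℝ) / 2))
    (hτ : 0 < τ) (t : H) :
    charFun (P.map (X τ)) t = Complex.exp
      (-(⟪(Real.exp (-(τ : ℝ)) • Cμ + (1 - Real.exp (-(τ : ℝ))) • C) t, t⟫ : ℝ) / 2) := by
  have h := charFun_initial_add_state hR hW hX hlaw hτ 0 t
  simp only [inner_zero_left, zero_add] at h
  rw [← charFun_map_inner (hX.measurable τ).aemeasurable, h]
  have ha : Real.exp (-(τ : ℝ)) = Real.exp (-(τ : ℝ) / 2) * Real.exp (-(τ : ℝ) / 2) := by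
    rw [← Real.exp_add]; ring_nf
  simp only [map_smul, real_inner_smul_left, real_inner_smul_right, inner_add_left,
    add_apply, smul_apply]
  rw [ha]
  ring_nf

variable [CompleteSpace H]

/-- The residual `X₀ - T X_τ` is independent of `X_τ` if `T` solves the normal equation. -/
lemma indepFun_residual [IsProbabilityMeasure P] (hR : IsPositiveSqrt R C)
    (hW : IsCylindricalWiener W P) (hX : IsForwardDiffusion R W X P)
    (hC : (C : H →ₗ[ℝ] H).IsSymmetric) (hCμ : (Cμ : H →ₗ[ℝ] H).IsSymmetric)
    (hT : (T : H →ₗ[ℝ] H).IsSymmetric)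
    (hlaw : ∀ t, charFun (P.map (X 0)) t = Complex.exp (-(⟪Cμ t, t⟫ : ℝ) / 2))
    (hτ : 0 < τ)
    (hnormal : ∀ x, Real.exp (-(τ : ℝ) / 2) • Cμ (x - Real.exp (-(τ : ℝ) / 2) • T x) =
      (1 - Real.exp (-(τ : ℝ))) • C (T x)) :
    IndepFun (fun ω => X 0 ω - T (X τ ω)) (X τ) P := by
  have hX0 := hX.measurable 0
  have hXτ := hX.measurable τ
  rw [indepFun_iff_charFun_prod (by fun_prop) (by fun_prop)]
  intro t
  have hTs : ∀ x y, ⟪x, T y⟫ = ⟪T x, y⟫ := fun x y => (hT x y).symm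
  have h1 : charFun (P.map fun ω => WithLp.toLp 2 (X 0 ω - T (X τ ω), X τ ω)) t =
      charFun (P.map fun ω => ⟪t.ofLp.1, X 0 ω⟫ + ⟪t.ofLp.2 - T t.ofLp.1, X τ ω⟫) 1 := by
    rw [← charFun_map_inner (by fun_prop)]
    congr 3
    ext ω
    simp only [WithLp.prod_inner_apply, inner_sub_right, inner_sub_left, hTs]
    ring
  have h2 : charFun (P.map fun ω => X 0 ω - T (X τ ω)) t.ofLp.1 =
      charFun (P.map fun ω => ⟪t.ofLp.1, X 0 ω⟫ + ⟪-T t.ofLp.1, X τ ω⟫) 1 := by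
    rw [← charFun_map_inner (by fun_prop)]
    congr 3
    ext ω
    simp only [inner_sub_right, inner_neg_left, hTs]
    ring
  have h3 : charFun (P.map (X τ)) t.ofLp.2 =
      charFun (P.map fun ω => ⟪(0 : H), X 0 ω⟫ + ⟪t.ofLp.2, X τ ω⟫) 1 := by
    rw [← charFun_map_inner (by fun_prop)]
    simp only [inner_zero_left, zero_add]
  rw [h1, h2, h3, charFun_initial_add_state hR hW hX hlaw hτ,
    charFun_initial_add_state hR hW hX hlaw hτ, charFun_initial_add_state hR hW hX hlaw hτ,
    ← Complex.exp_add]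
  generalize t.ofLp.1 = u
  generalize t.ofLp.2 = v
  set a := Real.exp (-(τ : ℝ) / 2)
  set s := 1 - Real.exp (-(τ : ℝ))
  have hp : u + a • (v - T u) = (u - a • T u) + a • v := by module
  have hp' : u + a • (-T u) = u - a • T u := by module
  have hn : a * ⟪Cμ (u - a • T u), v⟫ = s * ⟪C (T u), v⟫ := by
    rw [← real_inner_smul_left, ← real_inner_smul_left, hnormal]
  rw [hp, hp', zero_add]
  generalize u - a • T u = p at *
  have hc1 : ⟪Cμ v, p⟫ = ⟪Cμ p, v⟫ := by rw [real_inner_comm]; exact (hCμ p v).symm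
  have hc2 : ⟪C v, T u⟫ = ⟪C (T u), v⟫ := by rw [real_inner_comm]; exact (hC (T u) v).symm
  -- With `p = u - a T u`, the cross terms are `2 (a ⟪Cμ p, v⟫ - s ⟪C (T u), v⟫)`, and the normal
  -- equation cancels them.
  have hq : ⟪Cμ (p + a • v), p + a • v⟫ + s * ⟪C (v - T u), v - T u⟫ =
      (⟪Cμ p, p⟫ + s * ⟪C (-T u), -T u⟫) + (⟪Cμ (a • v), a • v⟫ + s * ⟪C v, v⟫) := by
    simp only [map_add, map_sub, map_neg, map_smul, inner_add_left, inner_add_right,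
      inner_sub_left, inner_sub_right, inner_neg_left, inner_neg_right, real_inner_smul_left,
      real_inner_smul_right, hc1, hc2]
    linear_combination 2 * hn
  rw [hq]
  push_cast
  ring_nf

/-- In `Z = (Z - T Y) + T Y` the first term, independent of `Y`, has conditional expectation equal
to its mean `0`, and the second is a function of `Y`. -/
lemma condExp_eq_of_indepFun_residual [IsProbabilityMeasure P] {Z Y : Ω → H} (hZ : Measurable Z)
    (hY : Measurable Y) (hZi : Integrable Z P) (hYi : Integrable Y P) (hZ0 : ∫ ω, Z ω ∂P = 0)
    (hY0 : ∫ ω, Y ω ∂P = 0) (hind : IndepFun (fun ω => Z ω - T (Y ω)) Y P) :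
    (fun ω => T (Y ω)) =ᵐ[P] P[Z | MeasurableSpace.comap Y inferInstance] := by
  have hle : MeasurableSpace.comap Y inferInstance ≤ ‹MeasurableSpace Ω› := hY.comap_le
  have hTi : Integrable (fun ω => T (Y ω)) P := T.integrable_comp hYi
  have h1 : P[fun ω => Z ω - T (Y ω) | MeasurableSpace.comap Y inferInstance] =ᵐ[P]
      fun _ => ∫ ω, (Z ω - T (Y ω)) ∂P :=
    condExp_indep_eq (m₁ := MeasurableSpace.comap (fun ω => Z ω - T (Y ω)) inferInstance)
      (Measurable.comap_le (by fun_prop)) hle (comap_measurable _).stronglyMeasurable hind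
  have h0 : ∫ ω, (Z ω - T (Y ω)) ∂P = 0 := by
    rw [integral_sub hZi hTi, T.integral_comp_comm hYi, hZ0, hY0, map_zero, sub_zero]
  have h2 : P[fun ω => T (Y ω) | MeasurableSpace.comap Y inferInstance] = fun ω => T (Y ω) :=
    condExp_of_stronglyMeasurable hle
      (T.measurable.comp (comap_measurable Y)).stronglyMeasurable hTi
  have h3 := condExp_sub hZi hTi (MeasurableSpace.comap Y inferInstance)
  rw [h2] at h3
  have h4 : P[Z - fun ω => T (Y ω) | MeasurableSpace.comap Y inferInstance] =ᵐ[P]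
      fun _ => ∫ ω, (Z ω - T (Y ω)) ∂P := h1
  filter_upwards [h3, h4] with ω h3 h4
  rw [h4, h0] at h3
  exact (sub_eq_zero.1 h3.symm).symm

end Regression

/-! ### The score, the mismatch formula and its limit. -/

section Score

/-- Each coordinate tends to `0`, and square-summability of `p j * ⟪e j, x⟫`, the coordinates of
`y`, supplies the majorant even when `p` is unbounded. -/
lemma tendsto_norm_sq_of_inner_eq {H : Type*} [NormedAddCommGroup H] [InnerProductSpace ℝ H]
    {e : HilbertBasis ℕ ℝ H} {p : ℕ → ℝ} (hp : ∀ j, 0 < p j) {x y : H}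
    (hy : ∀ j, ⟪e j, y⟫ = p j * ⟪e j, x⟫) {F : ℝ≥0 → H}
    (hF : ∀ τ : ℝ≥0, 0 < τ → ∀ j, ⟪e j, F τ⟫ = (Real.exp τ - 1) *
      ((p j - 1) / (1 + (Real.exp τ - 1) * p j) * p j * ⟪x, e j⟫)) :
    Tendsto (fun τ => ‖F τ‖ ^ 2) (𝓝[>] 0) (𝓝 0) := by
  have hpars : ∀ z : H, ‖z‖ ^ 2 = ∑' j, ⟪e j, z⟫ ^ 2 := fun z => by
    rw [← real_inner_self_eq_norm_sq, ← e.tsum_inner_mul_inner]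
    exact tsum_congr fun j => by rw [real_inner_comm, sq]
  have hsum : Summable fun j => 4 * ⟪e j, y⟫ ^ 2 := by
    refine Summable.mul_left _ ((e.summable_inner_mul_inner y y).congr fun j => ?_)
    rw [real_inner_comm, sq]
  have hpos : ∀ᶠ τ : ℝ≥0 in 𝓝[>] 0, 0 < τ := self_mem_nhdsWithin
  have hexp : Tendsto (fun τ : ℝ≥0 => Real.exp τ - 1) (𝓝[>] 0) (𝓝 0) := by
    have : Continuous fun τ : ℝ≥0 => Real.exp τ - 1 := by fun_prop
    have h := (this.tendsto 0).mono_left (nhdsWithin_le_nhds (s := Set.Ioi 0))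
    simpa using h
  have hle : ∀ᶠ τ : ℝ≥0 in 𝓝[>] 0, Real.exp τ - 1 ≤ 1 :=
    (hexp.eventually_lt_const one_pos).mono fun _ h => h.le
  simp only [hpars]
  rw [← tsum_zero (α := ℝ) (β := ℕ)]
  refine tendsto_tsum_of_dominated_convergence hsum (fun j => ?_) ?_
  · have hcont : ContinuousAt (fun c : ℝ =>
        (c * ((p j - 1) / (1 + c * p j) * p j * ⟪x, e j⟫)) ^ 2) 0 := by
      have : (1 : ℝ) + 0 * p j ≠ 0 := by simp
      fun_prop (disch := assumption)
    have h := hcont.tendsto.comp hexp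
    simp only [zero_mul, ne_eq, OfNat.ofNat_ne_zero, not_false_eq_true, zero_pow] at h
    refine h.congr' ?_
    filter_upwards [hpos] with τ hτ
    rw [hF τ hτ, Function.comp_apply]
  · filter_upwards [hpos, hle] with τ hτ hle j
    have hc : 0 < Real.exp τ - 1 := sub_pos.2 (Real.one_lt_exp_iff.2 hτ)
    rw [hF τ hτ, hy, real_inner_comm]
    generalize Real.exp τ - 1 = c at *
    have hcp := mul_pos hc (hp j)
    have hden : 0 < 1 + c * p j := by positivity
    -- As `c ≤ 1`, `c |p - 1| ≤ c p + c ≤ 1 + c p`, so `2` is generous; its square is the `4` in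
    -- `hsum`.
    have hq : |c * (p j - 1) / (1 + c * p j)| ≤ 2 := by
      have hpj := hp j
      rw [abs_le, le_div_iff₀ hden, div_le_iff₀ hden]
      constructor <;> nlinarith
    have heq : c * ((p j - 1) / (1 + c * p j) * p j * ⟪e j, x⟫) =
        c * (p j - 1) / (1 + c * p j) * (p j * ⟪e j, x⟫) := by ring
    rw [heq, Real.norm_eq_abs, abs_pow, abs_mul, mul_pow, sq_abs (p j * _)]
    have h4 : |c * (p j - 1) / (1 + c * p j)| ^ 2 ≤ 4 := by
      nlinarith [abs_nonneg (c * (p j - 1) / (1 + c * p j))]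
    exact mul_le_mul_of_nonneg_right h4 (sq_nonneg _)

variable {H : Type*} [NormedAddCommGroup H] [InnerProductSpace ℝ H] [CompleteSpace H]
  [SecondCountableTopology H] [MeasurableSpace H] [BorelSpace H]
  {C Cμ R : H →L[ℝ] H} {Ω : Type*} [MeasurableSpace Ω] {P : Measure Ω}
  {W : ℝ≥0 → H → Ω → ℝ} {X : ℝ≥0 → Ω → H} {e : HilbertBasis ℕ ℝ H} {lam mu : ℕ → ℝ}

lemma one_sub_exp_neg_pos {τ : ℝ≥0} (hτ : 0 < τ) : 0 < 1 - Real.exp (-(τ : ℝ)) := by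
  have : (0 : ℝ) < τ := hτ
  simpa using this

lemma exp_neg_half_mul_self (t : ℝ) :
    Real.exp (-t / 2) * Real.exp (-t / 2) = Real.exp (-t) := by
  rw [← Real.exp_add]; ring_nf

/-- The regression function of the Gaussian pair `(X₀, X_τ)` is linear and diagonal, and it is the
only continuous version. -/
lemma exists_regression [IsProbabilityMeasure P] (hC : IsCovarianceOperator C)
    (hCμ : IsCovarianceOperator Cμ) (hR : IsPositiveSqrt R C)
    (hlam : ∀ j, C (e j) = lam j • e j) (hmu : ∀ j, Cμ (e j) = mu j • e j)
    (hW : IsCylindricalWiener W P) (hX : IsForwardDiffusion R W X P)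
    (hlaw : ∀ t, charFun (P.map (X 0)) t = Complex.exp (-(⟪Cμ t, t⟫ : ℝ) / 2))
    {τ : ℝ≥0} (hτ : 0 < τ) :
    ∃ T : H →L[ℝ] H, (∀ x j, ⟪e j, T x⟫ = Real.exp (-(τ : ℝ) / 2) * mu j /
        (Real.exp (-(τ : ℝ)) * mu j + (1 - Real.exp (-(τ : ℝ))) * lam j) * ⟪e j, x⟫) ∧
      IsContinuousRegression (X 0) (X τ) P T ∧
      ∀ m, IsContinuousRegression (X 0) (X τ) P m → m = T := by
  have hlam0 : ∀ j, 0 < lam j := fun j => eigenvalue_pos hC (e.orthonormal.1 j) (hlam j)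
  have hmu0 : ∀ j, 0 < mu j := fun j => eigenvalue_pos hCμ (e.orthonormal.1 j) (hmu j)
  have hs := one_sub_exp_neg_pos hτ
  have ha := exp_neg_half_mul_self (τ : ℝ)
  have hstate := charFun_state hR hW hX hlaw hτ
  set a := Real.exp (-(τ : ℝ) / 2) with ha_def
  set E := Real.exp (-(τ : ℝ)) with hE_def
  have ha0 : 0 < a := Real.exp_pos _
  have hE0 : 0 < E := Real.exp_pos _
  have hD0 : ∀ j, 0 < E * mu j + (1 - E) * lam j := fun j =>
    add_pos (mul_pos hE0 (hmu0 j)) (mul_pos hs (hlam0 j))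
  -- The entries are bounded uniformly in `j`: since `E = a²`, the denominator is at least `a² * mu
  -- j`, whence the bound `a⁻¹`.
  obtain ⟨T, hT⟩ := exists_diagonal e
    (m := fun j => a * mu j / (E * mu j + (1 - E) * lam j)) (M := a⁻¹) fun j => by
      rw [abs_of_pos (div_pos (mul_pos ha0 (hmu0 j)) (hD0 j)), div_le_iff₀ (hD0 j), ← ha,
        mul_add, ← mul_assoc, ← mul_assoc, inv_mul_cancel₀ ha0.ne', one_mul, ha]
      have := mul_pos (inv_pos.2 ha0) (mul_pos hs (hlam0 j))
      linarith
  have hnormal : ∀ x, a • Cμ (x - a • T x) = (1 - E) • C (T x) := fun x => by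
    refine ext_hilbertBasis e fun j => ?_
    rw [real_inner_smul_right, real_inner_smul_right,
      inner_apply_of_eigenvector hCμ.isSymmetric (hmu j),
      inner_apply_of_eigenvector hC.isSymmetric (hlam j), inner_sub_right, real_inner_smul_right, hT]
    have hq := div_mul_cancel₀ (a * mu j) (hD0 j).ne'
    generalize a * mu j / (E * mu j + (1 - E) * lam j) = q at hq ⊢
    linear_combination -⟪e j, x⟫ * hq - ⟪e j, x⟫ * mu j * q * ha
  set K := E • Cμ + (1 - E) • C with hK_def
  have hKs : (K : H →ₗ[ℝ] H).IsSymmetric := by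
    intro x y
    have h1 := hCμ.isSymmetric x y
    have h2 := hC.isSymmetric x y
    simp only [ContinuousLinearMap.coe_coe] at h1 h2 ⊢
    simp only [hK_def, add_apply, smul_apply, inner_add_left,
      inner_add_right, real_inner_smul_left, real_inner_smul_right, h1, h2]
  have hKe : ∀ j, K (e j) = (E * mu j + (1 - E) * lam j) • e j := fun j => by
    simp only [hK_def, add_apply, smul_apply, hlam, hmu, smul_smul, add_smul]
  have hnn : ∀ {D : H →L[ℝ] H}, IsCovarianceOperator D → ∀ x, 0 ≤ ⟪D x, x⟫ := fun {D} hD x => by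
    rcases eq_or_ne x 0 with rfl | hx
    · simp
    · exact (hD.posDef x hx).le
  have hKp : K.IsPositive := by
    refine ⟨hKs, fun x => ?_⟩
    have h1 := mul_nonneg hE0.le (hnn hCμ x)
    have h2 := mul_nonneg hs.le (hnn hC x)
    simp only [ContinuousLinearMap.reApplyInnerSelf_apply, hK_def, add_apply, smul_apply,
      inner_add_left, real_inner_smul_left, RCLike.re_to_real]
    linarith
  have hX0 := hX.measurable 0
  have hXτ := hX.measurable τ
  have : IsProbabilityMeasure (P.map (X 0)) := Measure.isProbabilityMeasure_map hX0.aemeasurable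
  have : IsProbabilityMeasure (P.map (X τ)) := Measure.isProbabilityMeasure_map hXτ.aemeasurable
  have hCμp : Cμ.IsPositive := ⟨hCμ.isSymmetric, fun x => hnn hCμ x⟩
  have : IsGaussian (P.map (X 0)) := isGaussian_of_charFun_eq hCμp hlaw
  have : IsGaussian (P.map (X τ)) := isGaussian_of_charFun_eq hKp hstate
  have hint : ∀ t, Measurable (X t) → IsGaussian (P.map (X t)) → Integrable (X t) P :=
    fun t hm _ => (integrable_map_measure aestronglyMeasurable_id hm.aemeasurable).1
      IsGaussian.integrable_id
  have hm0 : ∫ ω, X 0 ω ∂P = 0 := by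
    have := integral_eq_zero_of_charFun_eq hlaw
    rwa [integral_map hX0.aemeasurable (by fun_prop)] at this
  have hmτ : ∫ ω, X τ ω ∂P = 0 := by
    have := integral_eq_zero_of_charFun_eq hstate
    rwa [integral_map hXτ.aemeasurable (by fun_prop)] at this
  have hreg : IsContinuousRegression (X 0) (X τ) P T :=
    ⟨T.continuous, condExp_eq_of_indepFun_residual hX0 hXτ (hint 0 hX0 ‹_›) (hint τ hXτ ‹_›)
      hm0 hmτ (indepFun_residual hR hW hX hC.isSymmetric hCμ.isSymmetric
        (isSymmetric_of_diagonal e hT) hlaw hτ hnormal)⟩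
  refine ⟨T, hT, hreg, fun m hm => ?_⟩
  -- Full support of the law of `X τ` upgrades almost sure equality of continuous versions to
  -- equality everywhere.
  have := isOpenPosMeasure_of_charFun_eq hKs hstate e hKe hD0
  have hae : m =ᵐ[P.map (X τ)] T := by
    refine (ae_map_iff hXτ.aemeasurable
      (isClosed_eq hm.1 T.continuous).measurableSet).2 ?_
    exact hm.2.trans hreg.2.symm
  exact Measure.eq_of_ae_eq hae hm.1 T.continuous

/-- This is the mismatch in one coordinate, with `a = e^{-τ/2}`, `b = e^τ` and eigenvalues `l`, `m`.
Cancelling `b⁻¹` in the regression coefficient reveals the common denominator `m + (b - 1) l`. -/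
lemma mismatch_identity {a b l m : ℝ} (hb : 1 < b) (ha : a * a = b⁻¹) (hl : 0 < l) (hm : 0 < m) :
    l / m - (1 - b⁻¹)⁻¹ * (1 - a * (a * m / (b⁻¹ * m + (1 - b⁻¹) * l))) =
      (b - 1) * ((l / m - 1) / (1 + (b - 1) * (l / m)) * (l / m)) := by
  have hb0 : b ≠ 0 := by positivity
  have hb1 : b - 1 ≠ 0 := (sub_pos.2 hb).ne'
  have hD : m + (b - 1) * l ≠ 0 := by
    have := mul_pos (sub_pos.2 hb) hl
    positivity
  have h1 : a * (a * m / (b⁻¹ * m + (1 - b⁻¹) * l)) = m / (m + (b - 1) * l) := by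
    rw [← mul_div_assoc, ← mul_assoc, ha]
    have : b⁻¹ * m + (1 - b⁻¹) * l = b⁻¹ * (m + (b - 1) * l) := by field_simp
    rw [this, mul_div_mul_left _ _ (inv_ne_zero hb0)]
  have h2 : 1 + (b - 1) * (l / m) = (m + (b - 1) * l) / m := by field_simp
  have h3 : 1 - b⁻¹ = (b - 1) / b := by field_simp
  rw [h1, h2, h3]
  obtain ⟨D, hDdef⟩ : ∃ D, D = m + (b - 1) * l := ⟨_, rfl⟩
  rw [← hDdef] at hD ⊢
  field_simp
  rw [hDdef]
  ring

lemma inner_quotientOperator_add_score [IsProbabilityMeasure P] (hC : IsCovarianceOperator C)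
    (hCμ : IsCovarianceOperator Cμ) (hR : IsPositiveSqrt R C)
    (hlam : ∀ j, C (e j) = lam j • e j) (hmu : ∀ j, Cμ (e j) = mu j • e j)
    (hW : IsCylindricalWiener W P) (hX : IsForwardDiffusion R W X P)
    (hlaw : ∀ t, charFun (P.map (X 0)) t = Complex.exp (-(⟪Cμ t, t⟫ : ℝ) / 2))
    {τ : ℝ≥0} (hτ : 0 < τ) (x : (quotientOperator C Cμ).domain) (j : ℕ) :
    ⟪e j, quotientOperator C Cμ x + score X P τ x⟫ =
      (Real.exp τ - 1) * (((lam j / mu j - 1) / (1 + (Real.exp τ - 1) * (lam j / mu j))) *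
        (lam j / mu j) * ⟪(x : H), e j⟫) := by
  obtain ⟨T, hT, hreg, huniq⟩ := exists_regression hC hCμ hR hlam hmu hW hX hlaw hτ
  have hex : ∃ m, IsContinuousRegression (X 0) (X τ) P m := ⟨T, hreg⟩
  -- `condMean` selects a version by choice; uniqueness identifies it with `T`.
  have hcond : condMean (X 0) (X τ) P = T := by
    rw [condMean, dif_pos hex]
    exact huniq _ hex.choose_spec
  have hid := mismatch_identity (a := Real.exp (-(τ : ℝ) / 2)) (b := Real.exp τ)
    (Real.one_lt_exp_iff.2 hτ) (by rw [exp_neg_half_mul_self, Real.exp_neg])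
    (eigenvalue_pos hC (e.orthonormal.1 j) (hlam j))
    (eigenvalue_pos hCμ (e.orthonormal.1 j) (hmu j))
  rw [← Real.exp_neg] at hid
  rw [inner_add_right, inner_quotientOperator hC hCμ hlam hmu, score, hcond, inner_neg_right,
    real_inner_smul_right, inner_sub_right, real_inner_smul_right, hT, real_inner_comm (e j)]
  linear_combination ⟪e j, (x : H)⟫ * hid

end Score

end ScoreDiffusion

theorem mainTheorem3
    {H : Type*} [NormedAddCommGroup H] [InnerProductSpace ℝ H] [CompleteSpace H]
    [SecondCountableTopology H] [MeasurableSpace H] [BorelSpace H]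
    (C Cμ R : H →L[ℝ] H)
    (hC : ScoreDiffusion.IsCovarianceOperator C)
    (hCμ : ScoreDiffusion.IsCovarianceOperator Cμ)
    (hR : ScoreDiffusion.IsPositiveSqrt R C)
    (e : HilbertBasis ℕ ℝ H) (lam mu : ℕ → ℝ)
    (hlam : ∀ j, C (e j) = lam j • e j)
    (hmu : ∀ j, Cμ (e j) = mu j • e j)
    (μ₀ : Measure H) [IsGaussian μ₀]
    (hmean : ∫ x, x ∂μ₀ = 0) (hcov : covarianceOperator μ₀ = Cμ)
    {Ω : Type*} [MeasurableSpace Ω] (P : Measure Ω) [IsProbabilityMeasure P]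
    (W : ℝ≥0 → H → Ω → ℝ) (hW : ScoreDiffusion.IsCylindricalWiener W P)
    (X : ℝ≥0 → Ω → H) (hX : ScoreDiffusion.IsForwardDiffusion R W X P)
    (hX₀ : HasLaw (X 0) μ₀ P) :
    -- for `τ > 0` the regression function has exactly one continuous version
    (∀ τ : ℝ≥0, 0 < τ →
      ∃! m : H → H, ScoreDiffusion.IsContinuousRegression (X 0) (X τ) P m) ∧
    -- `C Cμ⁻¹` is defined on all of `H` when the ratios are bounded
    (BddAbove (Set.range fun j => lam j / mu j) →
      (ScoreDiffusion.quotientOperator C Cμ).domain = ⊤) ∧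
    ∀ x : (ScoreDiffusion.quotientOperator C Cμ).domain,
      (∀ τ : ℝ≥0, 0 < τ →
        Summable (fun j : ℕ =>
          (((lam j / mu j - 1) / (1 + (Real.exp τ - 1) * (lam j / mu j))) *
            (lam j / mu j) * ⟪(x : H), e j⟫) • e j) ∧
        ScoreDiffusion.quotientOperator C Cμ x + ScoreDiffusion.score X P τ x =
          (Real.exp τ - 1) • ∑' j : ℕ,
            (((lam j / mu j - 1) / (1 + (Real.exp τ - 1) * (lam j / mu j))) *
              (lam j / mu j) * ⟪(x : H), e j⟫) • e j) ∧
      Tendsto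
        (fun τ : ℝ≥0 =>
          ‖ScoreDiffusion.score X P τ x + ScoreDiffusion.quotientOperator C Cμ x‖ ^ 2)
        (𝓝[>] 0) (𝓝 0) := by
  have hlaw : ∀ t, charFun (P.map (X 0)) t = Complex.exp (-(⟪Cμ t, t⟫ : ℝ) / 2) := by
    rw [hX₀.map_eq]
    exact ScoreDiffusion.charFun_eq_of_covarianceOperator hmean hcov
  have hcoord := fun (τ : ℝ≥0) (hτ : 0 < τ) =>
    ScoreDiffusion.inner_quotientOperator_add_score hC hCμ hR hlam hmu hW hX hlaw hτ
  refine ⟨fun τ hτ => ?_, ScoreDiffusion.domain_quotientOperator_eq_top hC hCμ hlam hmu,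
    fun x => ⟨fun τ hτ => ?_, ?_⟩⟩
  · obtain ⟨T, -, hreg, huniq⟩ :=
      ScoreDiffusion.exists_regression hC hCμ hR hlam hmu hW hX hlaw hτ
    exact ⟨T, hreg, huniq⟩
  · have hb : Real.exp τ - 1 ≠ 0 := (sub_pos.2 (Real.one_lt_exp_iff.2 hτ)).ne'
    -- The series is the basis expansion of the left-hand vector divided by `e^τ - 1`, so it needs
    -- no separate convergence estimate.
    have hsum := (ScoreDiffusion.hasSum_hilbertBasis e (ScoreDiffusion.quotientOperator C Cμ x +
      ScoreDiffusion.score X P τ x)).const_smul (Real.exp τ - 1)⁻¹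
    simp only [real_inner_comm (e _) (_ + _), hcoord τ hτ, smul_smul, inv_mul_cancel_left₀ hb]
      at hsum
    refine ⟨hsum.summable, ?_⟩
    rw [hsum.tsum_eq, smul_smul, mul_inv_cancel₀ hb, one_smul]
  · refine ScoreDiffusion.tendsto_norm_sq_of_inner_eq
      (fun j => div_pos (ScoreDiffusion.eigenvalue_pos hC (e.orthonormal.1 j) (hlam j))
        (ScoreDiffusion.eigenvalue_pos hCμ (e.orthonormal.1 j) (hmu j)))
      (ScoreDiffusion.inner_quotientOperator hC hCμ hlam hmu x) (fun τ hτ j => ?_)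
    rw [add_comm, hcoord τ hτ]
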